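/- **Theorem (Game value).** Let $n\ge 1$, let $\Omega\subset\mathbb R^n$ be a nonempty bounded open set (for instance a bounded domain), $\varepsilon>0$, $p\ge 2$, and put $$\tilde\alpha=\frac{p-2}{p+n+1},\qquad \tilde\beta=\frac{n+3}{p+n+1},\qquad \Gamma_\varepsilon=\{x\in\mathbb R^n\setminus\Omega:\operatorname{dist}(x,\Omega)\le\varepsilon\},\qquad \Omega_\varepsilon=\Omega\cup\Gamma_\varepsilon,$$ $$\rho_\varepsilon(h)=\frac{2\sqrt{\varepsilon^2-|h|^2}}{|B^{n+1}_\varepsilon|}\quad(h\in B_\varepsilon(0)\subset\mathbb R^n),$$ where $|B^{n+1}_\varepsilon|$ is the volume of a ball of radius $\varepsilon$ in $\mathbb R^{n+1}$. Let $F:\Gamma_\varepsilon\to\mathbb R$ be bounded and Borel. For bounded $u:\Omega_\varepsilon\to\mathbb R$ and $x\in\Omega$ let $$S^+[u](x)=\sup_{y\in\Omega_\varepsilon,\ |y-x|<\varepsilon}\Bigl(u(y)+\sqrt{\varepsilon^2-|y-x|^2}\Bigr),\qquad S^-[u](x)=\inf_{y\in\Omega_\varepsilon,\ |y-x|<\varepsilon}\Bigl(u(y)-\sqrt{\varepsilon^2-|y-x|^2}\Bigr).$$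 *The game.* States are pairs $(x,s)\in\Omega_\varepsilon\times\mathbb R$. A strategy is a sequence of Borel maps, one for each $k\ge 0$, from histories $h_k=((x_0,s_0),\dots,(x_k,s_k))$ to points of $\Omega_\varepsilon$, whose value $y$ satisfies $|y-x_k|<\varepsilon$ whenever $x_k\in\Omega$. If $x_k\in\Gamma_\varepsilon$ the state no longer changes. If $x_k\in\Omega$, then with probability $\tilde\beta$ the next state is $(x_k+h,s_k)$ with $h$ drawn from the density $\rho_\varepsilon$ on $B_\varepsilon(0)$; with probability $\tilde\alpha/2$ it is $(y,\,s_k+\sqrt{\varepsilon^2-|y-x_k|^2})$ with $y=S_I(h_k)$ chosen by Player I; and with probability $\tilde\alpha/2$ it is $(y,\,s_k-\sqrt{\varepsilon^2-|y-x_k|^2})$ with $y=S_{II}(h_k)$ chosen by Player II. Let $\mathbb P^{(x_0,s_0)}_{S_I,S_{II}}$ be the resulting law on infinite sequences of states started at $(x_0,s_0)$, let $\tau=\inf\{k\ge 0: x_k\in\Gamma_\varepsilon\}$, and let $$u_I(x_0,s_0)=\sup_{S_I}\inf_{S_{II}}\mathbb E^{(x_0,s_0)}_{S_I,S_{II}}[F(x_\tau)+s_\tau],\qquad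 u_{II}(x_0,s_0)=\inf_{S_{II}}\sup_{S_I}\mathbb E^{(x_0,s_0)}_{S_I,S_{II}}[F(x_\tau)+s_\tau].$$ *Conclusion.* There is exactly one bounded Borel function $v_\varepsilon:\Omega_\varepsilon\to\mathbb R$ with $$v_\varepsilon(x)=\frac{\tilde\alpha}{2}\bigl(S^+[v_\varepsilon](x)+S^-[v_\varepsilon](x)\bigr)+\tilde\beta\int_{B_\varepsilon(0)}v_\varepsilon(x+h)\rho_\varepsilon(h)\,dh\quad(x\in\Omega),\qquad v_\varepsilon=F\ \text{ on }\Gamma_\varepsilon .$$ For every $(x_0,s_0)\in\Omega\times\mathbb R$ and all strategies $S_I,S_{II}$, $\tau<\infty$ almost surely and $F(x_\tau)+s_\tau$ is integrable, and $$u_I(x_0,s_0)=v_\varepsilon(x_0)+s_0=u_{II}(x_0,s_0).$$ In particular $u_I(x_0,0)=v_\varepsilon(x_0)=u_{II}(x_0,0)$ for every $x_0\in\Omega$. -/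

import Mathlib

open MeasureTheory ProbabilityTheory

noncomputable section

namespace TiltedTugOfWar

/-- The parameters of the game in `ℝⁿ`: a nonempty bounded open set `Ω`, a step size `ε > 0` and an
exponent `p ≥ 2`. -/
structure Setting (n : ℕ) where
  Ω : Set (EuclideanSpace ℝ (Fin n))
  isOpen : IsOpen Ω
  isBounded : Bornology.IsBounded Ω
  nonempty : Ω.Nonempty
  ε : ℝ
  ε_pos : 0 < ε
  p : ℝ
  two_le_p : 2 ≤ p

variable {n : ℕ} (G : Setting n)

namespace Setting

/-- The boundary strip `Γ_ε = {x ∉ Ω : dist(x, Ω) ≤ ε}`. -/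
def strip : Set (EuclideanSpace ℝ (Fin n)) := {x | x ∉ G.Ω ∧ Metric.infDist x G.Ω ≤ G.ε}

/-- The strip domain `Ω_ε = Ω ∪ Γ_ε`. -/
def stripDomain : Set (EuclideanSpace ℝ (Fin n)) := G.Ω ∪ G.strip

/-- Positions: points of `Ω_ε`. -/
abbrev Pos : Type := ↥G.stripDomain

/-- States `(x, s)`: a position together with a real score. -/
abbrev State : Type := G.Pos × ℝ

/-- `α = (p - 2) / (p + n + 1)`. -/
def α : ℝ := (G.p - 2) / (G.p + n + 1)

/-- `β = (n + 3) / (p + n + 1)`. -/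
def β : ℝ := (n + 3) / (G.p + n + 1)

/-- The semicircular kernel `ρ_ε(h) = 2 √(ε² - |h|²) / |B_ε^{n+1}|` (used for `|h| < ε`). -/
def ρ (h : EuclideanSpace ℝ (Fin n)) : ℝ :=
  2 * √(G.ε ^ 2 - ‖h‖ ^ 2) /
    volume.real (Metric.ball (0 : EuclideanSpace ℝ (Fin (n + 1))) G.ε)

/-- The score increment `√(ε² - |y - x|²)` attached to a move from `x` to `y`. -/
def tilt (x y : G.Pos) : ℝ := √(G.ε ^ 2 - dist y x ^ 2)

open Classical in
/-- The point `x + h` as an element of `Ω_ε`. It is used only for `x ∈ Ω` and `|h| < ε`, where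
`x + h` always lies in `Ω_ε` (see `coe_shift`); the other branch is never reached. -/
def shift (x : G.Pos) (h : EuclideanSpace ℝ (Fin n)) : G.Pos :=
  if hx : (x : EuclideanSpace ℝ (Fin n)) + h ∈ G.stripDomain then ⟨x + h, hx⟩ else x

lemma coe_shift {x : G.Pos} (hx : (x : EuclideanSpace ℝ (Fin n)) ∈ G.Ω)
    {h : EuclideanSpace ℝ (Fin n)} (hh : ‖h‖ < G.ε) :
    (G.shift x h : EuclideanSpace ℝ (Fin n)) = x + h := by
  have hmem : (x : EuclideanSpace ℝ (Fin n)) + h ∈ G.stripDomain := by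
    by_cases hm : (x : EuclideanSpace ℝ (Fin n)) + h ∈ G.Ω
    · exact Or.inl hm
    · refine Or.inr ⟨hm, ?_⟩
      refine (Metric.infDist_le_dist_of_mem hx).trans ?_
      simpa [dist_eq_norm] using hh.le
  simp [shift, hmem]

/-- `S⁺[u](x)`, the supremum of `u(y) + √(ε² - |y - x|²)` over `y ∈ Ω_ε` with `|y - x| < ε`. -/
def supTilt (u : G.Pos → ℝ) (x : G.Pos) : ℝ :=
  ⨆ y : {y : G.Pos // dist y x < G.ε}, (u y + G.tilt x y)

/-- `S⁻[u](x)`, the infimum of `u(y) - √(ε² - |y - x|²)` over `y ∈ Ω_ε` with `|y - x| < ε`. -/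
def infTilt (u : G.Pos → ℝ) (x : G.Pos) : ℝ :=
  ⨅ y : {y : G.Pos // dist y x < G.ε}, (u y - G.tilt x y)

/-- `v` is a bounded Borel function on `Ω_ε` that solves the projected dynamic programming
principle in `Ω` with boundary values `F` on `Γ_ε`. -/
structure IsSolution (F : G.strip → ℝ) (v : G.Pos → ℝ) : Prop where
  measurable : Measurable v
  bounded : ∃ C, ∀ x, |v x| ≤ C
  boundary : ∀ x : G.strip, v ⟨x, Or.inr x.2⟩ = F x
  interior : ∀ x : G.Pos, (x : EuclideanSpace ℝ (Fin n)) ∈ G.Ω →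
    v x = G.α / 2 * (G.supTilt v x + G.infTilt v x)
      + G.β * ∫ h in Metric.ball (0 : EuclideanSpace ℝ (Fin n)) G.ε, v (G.shift x h) * G.ρ h

/-- The noise law: the measure on `B_ε(0)` with density `ρ_ε`. -/
def noise : Measure (EuclideanSpace ℝ (Fin n)) :=
  (volume.restrict (Metric.ball 0 G.ε)).withDensity fun h => ENNReal.ofReal (G.ρ h)

/-- Histories `((x₀, s₀), …, (x_k, s_k))`. -/
abbrev History (k : ℕ) : Type := (i : Finset.Iic k) → G.State

/-- The current state `(x_k, s_k)` of a history of length `k`. -/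
def last {k : ℕ} (h : G.History k) : G.State := h ⟨k, Finset.mem_Iic.2 le_rfl⟩

/-- A strategy: a Borel function of the history that, whenever `x_k ∈ Ω`, selects a point of `Ω_ε`
at distance `< ε` from `x_k`. (Its values on histories with `x_k ∉ Ω` are never used.) -/
structure Strategy where
  move : (k : ℕ) → G.History k → G.Pos
  measurable : ∀ k, Measurable (move k)
  admissible : ∀ k (h : G.History k),
    ((G.last h).1 : EuclideanSpace ℝ (Fin n)) ∈ G.Ω → dist (move k h) (G.last h).1 < G.ε

open Classical in
/-- The law of the state at time `k + 1` given the history up to time `k`. -/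
def stepLaw (S₁ S₂ : G.Strategy) (k : ℕ) (h : G.History k) : Measure G.State :=
  if ((G.last h).1 : EuclideanSpace ℝ (Fin n)) ∈ G.Ω then
    ENNReal.ofReal G.β • G.noise.map (fun z => (G.shift (G.last h).1 z, (G.last h).2))
    + ENNReal.ofReal (G.α / 2) • Measure.dirac
        (S₁.move k h, (G.last h).2 + G.tilt (G.last h).1 (S₁.move k h))
    + ENNReal.ofReal (G.α / 2) • Measure.dirac
        (S₂.move k h, (G.last h).2 - G.tilt (G.last h).1 (S₂.move k h))
  else Measure.dirac (G.last h)

/-! Facts needed to see that `stepLaw` is a Markov kernel. -/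

lemma measurable_last (k : ℕ) : Measurable (G.last (k := k)) := measurable_pi_apply _

lemma measurable_ρ : Measurable G.ρ := by
  unfold ρ; fun_prop

lemma measurableSet_strip : MeasurableSet G.strip :=
  G.isOpen.measurableSet.compl.inter
    (measurableSet_le (Metric.continuous_infDist_pt _).measurable measurable_const)

lemma measurableSet_stripDomain : MeasurableSet G.stripDomain :=
  G.isOpen.measurableSet.union G.measurableSet_strip

lemma measurable_shift :
    Measurable fun q : G.Pos × EuclideanSpace ℝ (Fin n) => G.shift q.1 q.2 := by
  classical
  have hadd : Measurable fun q : G.Pos × EuclideanSpace ℝ (Fin n) =>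
      (q.1 : EuclideanSpace ℝ (Fin n)) + q.2 := by fun_prop
  let s : Set (G.Pos × EuclideanSpace ℝ (Fin n)) :=
    {q | (q.1 : EuclideanSpace ℝ (Fin n)) + q.2 ∈ G.stripDomain}
  have hs : MeasurableSet s := hadd G.measurableSet_stripDomain
  have h₁ : Measurable fun q : s => (⟨(q.1.1 : EuclideanSpace ℝ (Fin n)) + q.1.2, q.2⟩ : G.Pos) :=
    (hadd.comp measurable_subtype_coe).subtype_mk
  have h₂ : Measurable fun q : (sᶜ : Set (G.Pos × EuclideanSpace ℝ (Fin n))) => q.1.1 :=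
    measurable_fst.comp measurable_subtype_coe
  exact Measurable.dite h₁ h₂ hs

lemma measurable_tilt : Measurable fun q : G.Pos × G.Pos => G.tilt q.1 q.2 := by
  unfold tilt
  exact ((measurable_const.sub ((measurable_snd.dist measurable_fst).pow_const 2))).sqrt

/-- The volume of the `(m + 1)`-dimensional ball, computed by slicing along the first coordinate. -/
lemma volume_ball_succ (m : ℕ) (r : ℝ) :
    volume (Metric.ball (0 : EuclideanSpace ℝ (Fin (m + 1))) r)
      = ∫⁻ h in Metric.ball (0 : EuclideanSpace ℝ (Fin m)) r,
          ENNReal.ofReal (2 * √(r ^ 2 - ‖h‖ ^ 2)) := by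
  rcases le_or_gt r 0 with hr | hr
  · simp [Metric.ball_eq_empty.2 hr]
  let f : EuclideanSpace ℝ (Fin m) → ℝ := fun h => √(r ^ 2 - ‖h‖ ^ 2)
  have hf : Measurable f := by fun_prop
  have hreg := volume_regionBetween_eq_lintegral' (μ := volume) hf.neg hf
    (measurableSet_ball (x := (0 : EuclideanSpace ℝ (Fin m))) (ε := r))
  have e1 := (PiLp.volume_preserving_toLp (Fin (m + 1)))
  have e2 := (volume_preserving_piFinSuccAbove (fun _ : Fin (m + 1) => ℝ) 0).symm
  have e3 := (MeasurePreserving.id (volume : Measure ℝ)).prod (PiLp.volume_preserving_ofLp (Fin m))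
  have e4 := Measure.measurePreserving_swap
    (μ := (volume : Measure (EuclideanSpace ℝ (Fin m)))) (ν := (volume : Measure ℝ))
  have e := e1.comp (e2.comp (e3.comp e4))
  rw [← e.measure_preimage measurableSet_ball.nullMeasurableSet]
  have hset : ((WithLp.toLp 2 ∘ (MeasurableEquiv.piFinSuccAbove (fun _ => ℝ) 0).symm ∘
      Prod.map id WithLp.ofLp ∘ Prod.swap) ⁻¹'
        Metric.ball (0 : EuclideanSpace ℝ (Fin (m + 1))) r) =
      regionBetween (-f) f (Metric.ball (0 : EuclideanSpace ℝ (Fin m)) r) := by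
    ext ⟨h, t⟩
    have hn : ∀ (k : ℕ) (z : EuclideanSpace ℝ (Fin k)), ‖z‖ < r ↔ ∑ i, z i ^ 2 < r ^ 2 := by
      intro k z
      rw [← EuclideanSpace.real_norm_sq_eq, sq_lt_sq₀ (norm_nonneg _) hr.le]
    have hs : ‖h‖ ^ 2 = ∑ i, h i ^ 2 := EuclideanSpace.real_norm_sq_eq h
    have hmem : (‖h‖ < r ∧ -f h < t ∧ t < f h) ↔ t ^ 2 + ∑ i, h i ^ 2 < r ^ 2 := by
      rw [← abs_lt, ← hs]
      change (_ ∧ |t| < √(r ^ 2 - ‖h‖ ^ 2)) ↔ _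
      rw [Real.lt_sqrt (abs_nonneg _), sq_abs]
      constructor
      · rintro ⟨-, h2⟩; linarith
      · intro h2
        exact ⟨(sq_lt_sq₀ (norm_nonneg _) hr.le).1 (by nlinarith [sq_nonneg t]), by linarith⟩
    simp only [regionBetween, Set.mem_preimage, Function.comp_apply, Prod.swap_prod_mk,
      Prod.map_apply, id, mem_ball_zero_iff, Set.mem_ofPred_eq, Set.mem_Ioo, Pi.neg_apply]
    rw [hmem, hn, Fin.sum_univ_succ]
    simp [MeasurableEquiv.piFinSuccAbove]
  rw [hset]
  refine hreg.trans (lintegral_congr fun h => ?_)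
  congr 1
  simp only [Pi.sub_apply, Pi.neg_apply, f]
  ring

instance : IsProbabilityMeasure G.noise := by
  have hr := G.ε_pos
  set V := volume (Metric.ball (0 : EuclideanSpace ℝ (Fin (n + 1))) G.ε) with hV
  have hV0 : V ≠ 0 := (Metric.measure_ball_pos _ _ hr).ne'
  have hVt : V ≠ ⊤ := measure_ball_lt_top.ne
  have hρ : ∀ h, ENNReal.ofReal (G.ρ h) =
      ENNReal.ofReal (2 * √(G.ε ^ 2 - ‖h‖ ^ 2)) * V⁻¹ := fun h => by
    have hpos : 0 < V.toReal := ENNReal.toReal_pos hV0 hVt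
    unfold ρ
    rw [Measure.real, ENNReal.ofReal_div_of_pos hpos, ENNReal.ofReal_toReal hVt, div_eq_mul_inv]
  refine ⟨?_⟩
  rw [noise, withDensity_apply _ MeasurableSet.univ, Measure.restrict_univ]
  simp_rw [hρ]
  rw [lintegral_mul_const _ (by fun_prop), ← volume_ball_succ, ENNReal.mul_inv_cancel hV0 hVt]

lemma α_nonneg : 0 ≤ G.α :=
  div_nonneg (by linarith [G.two_le_p]) (by have := G.two_le_p; positivity)

lemma β_nonneg : 0 ≤ G.β :=
  div_nonneg (by positivity) (by have := G.two_le_p; positivity)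

lemma weights_sum : ENNReal.ofReal G.β + ENNReal.ofReal (G.α / 2) + ENNReal.ofReal (G.α / 2) = 1 := by
  have ha := G.α_nonneg
  have hb := G.β_nonneg
  rw [← ENNReal.ofReal_add hb (by linarith), ← ENNReal.ofReal_add (by linarith) (by linarith),
    ← ENNReal.ofReal_one]
  congr 1
  have h2 := G.two_le_p
  have : (0 : ℝ) < G.p + n + 1 := by positivity
  unfold α β
  field_simp
  ring

lemma measurable_dirac_coe {T S : Type*} [MeasurableSpace T] [MeasurableSpace S] {f : T → S}
    (hf : Measurable f) {A : Set S} (hA : MeasurableSet A) :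
    Measurable fun t => Measure.dirac (f t) A :=
  (Measure.measurable_coe hA).comp (Measure.measurable_dirac.comp hf)

lemma measurable_noise_map_coe {A : Set G.State} (hA : MeasurableSet A) :
    Measurable fun a : G.State => (G.noise.map fun z => (G.shift a.1 z, a.2)) A := by
  have hm : Measurable fun q : G.State × EuclideanSpace ℝ (Fin n) =>
      (G.shift q.1.1 q.2, q.1.2) :=
    (G.measurable_shift.comp ((measurable_fst.comp measurable_fst).prodMk measurable_snd)).prodMk
      (measurable_snd.comp measurable_fst)
  have he : (fun a : G.State => (G.noise.map fun z => (G.shift a.1 z, a.2)) A) = fun a =>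
      G.noise (Prod.mk a ⁻¹' ((fun q : G.State × EuclideanSpace ℝ (Fin n) =>
        (G.shift q.1.1 q.2, q.1.2)) ⁻¹' A)) := by
    funext a
    exact Measure.map_apply (hm.comp measurable_prodMk_left) hA
  rw [he]
  exact measurable_measure_prodMk_left (hm hA)

lemma measurable_add_tilt :
    Measurable fun q : G.State × G.Pos => (q.2, q.1.2 + G.tilt q.1.1 q.2) := by
  have hx : Measurable fun q : G.State × G.Pos => q.1.1 := measurable_fst.comp measurable_fst
  have hp : Measurable fun q : G.State × G.Pos => (q.1.1, q.2) := hx.prodMk measurable_snd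
  have h := G.measurable_tilt.comp hp
  exact measurable_snd.prodMk ((measurable_snd.comp measurable_fst).add h)

lemma measurable_sub_tilt :
    Measurable fun q : G.State × G.Pos => (q.2, q.1.2 - G.tilt q.1.1 q.2) := by
  have hx : Measurable fun q : G.State × G.Pos => q.1.1 := measurable_fst.comp measurable_fst
  have hp : Measurable fun q : G.State × G.Pos => (q.1.1, q.2) := hx.prodMk measurable_snd
  have h := G.measurable_tilt.comp hp
  exact measurable_snd.prodMk ((measurable_snd.comp measurable_fst).sub h)

lemma measurable_stepLaw (S₁ S₂ : G.Strategy) (k : ℕ) : Measurable (G.stepLaw S₁ S₂ k) := by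
  classical
  have hl := G.measurable_last k
  have hx : Measurable fun h : G.History k => (G.last h).1 := measurable_fst.comp hl
  have hΩ : MeasurableSet {h : G.History k | ((G.last h).1 : EuclideanSpace ℝ (Fin n)) ∈ G.Ω} :=
    (measurable_subtype_coe.comp hx) G.isOpen.measurableSet
  refine Measurable.ite hΩ ?_ (Measure.measurable_dirac.comp hl)
  refine Measure.measurable_of_measurable_coe _ fun A hA => ?_
  have h₀ := (G.measurable_noise_map_coe hA).comp hl
  have h₁ := measurable_dirac_coe
    (G.measurable_add_tilt.comp (hl.prodMk (S₁.measurable k))) hA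
  have h₂ := measurable_dirac_coe
    (G.measurable_sub_tilt.comp (hl.prodMk (S₂.measurable k))) hA
  exact ((h₀.const_mul (ENNReal.ofReal G.β)).add (h₁.const_mul (ENNReal.ofReal (G.α / 2)))).add
    (h₂.const_mul (ENNReal.ofReal (G.α / 2)))

/-- The one-step transition kernel from histories to states. -/
def stepKernel (S₁ S₂ : G.Strategy) (k : ℕ) : Kernel (G.History k) G.State where
  toFun := G.stepLaw S₁ S₂ k
  measurable' := G.measurable_stepLaw S₁ S₂ k

instance (S₁ S₂ : G.Strategy) (k : ℕ) : IsMarkovKernel (G.stepKernel S₁ S₂ k) where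
  isProbabilityMeasure h := by
    classical
    change IsProbabilityMeasure (G.stepLaw S₁ S₂ k h)
    unfold stepLaw
    split_ifs
    · have hm : Measurable fun z => (G.shift (G.last h).1 z, (G.last h).2) :=
        (G.measurable_shift.comp measurable_prodMk_left).prodMk measurable_const
      have := Measure.isProbabilityMeasure_map (μ := G.noise) hm.aemeasurable
      refine ⟨?_⟩
      simp only [Measure.coe_add, Measure.coe_smul, Pi.add_apply, Pi.smul_apply, smul_eq_mul,
        measure_univ, mul_one]
      exact G.weights_sum
    · infer_instance

/-- The law of the game on infinite state sequences, started at `a = (x₀, s₀)`: the Ionescu-Tulcea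
measure of the transition kernels. -/
def law (S₁ S₂ : G.Strategy) (a : G.State) : Measure (ℕ → G.State) :=
  Kernel.traj (X := fun _ => G.State) (G.stepKernel S₁ S₂) 0 fun _ => a

/-- The trajectory enters the strip `Γ_ε` at some time. -/
def Exits (ω : ℕ → G.State) : Prop := ∃ k, ((ω k).1 : EuclideanSpace ℝ (Fin n)) ∈ G.strip

open Classical in
/-- The payoff `F(x_τ) + s_τ`, where `τ` is the first time with `x_τ ∈ Γ_ε`
(and `0` if there is no such time). -/
def payoff (F : G.strip → ℝ) (ω : ℕ → G.State) : ℝ :=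
  if h : G.Exits ω then
    F ⟨(ω (Nat.find h)).1, Nat.find_spec h⟩ + (ω (Nat.find h)).2
  else 0

/-- The expected payoff. -/
def expectedPayoff (F : G.strip → ℝ) (S₁ S₂ : G.Strategy) (a : G.State) : ℝ :=
  ∫ ω, G.payoff F ω ∂(G.law S₁ S₂ a)

/-- The lower value `sup_{S₁} inf_{S₂} E[F(x_τ) + s_τ]`. -/
def lowerValue (F : G.strip → ℝ) (a : G.State) : EReal :=
  ⨆ S₁ : G.Strategy, ⨅ S₂ : G.Strategy, (G.expectedPayoff F S₁ S₂ a : EReal)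

/-- The upper value `inf_{S₂} sup_{S₁} E[F(x_τ) + s_τ]`. -/
def upperValue (F : G.strip → ℝ) (a : G.State) : EReal :=
  ⨅ S₂ : G.Strategy, ⨆ S₁ : G.Strategy, (G.expectedPayoff F S₁ S₂ a : EReal)

end Setting

end TiltedTugOfWar

end

/-!
The dynamic programming principle is a fixed-point equation `T v = v`, and everything rests on one
weight function. For `x ∈ Ω` and large `λ` the function `ψ(x) = 1 - c exp(λ x₁)` satisfies
`α + β ∫ ψ(x + h) ρ_ε(h) dh ≤ θ ψ(x)` with some `θ < 1`, because the noise alone makes the mean of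
the exponential grow; moreover `1/2 ≤ ψ ≤ 1` on `Ω_ε` (`exists_barrier`). This has two consequences.

* Analysis: the operators `u ↦ S⁺[u]`, `u ↦ S⁻[u]` are `1`-Lipschitz for the supremum norm, so `T`
  is a `θ`-contraction for the norm weighted by `ψ` (`abs_dppOp_sub_le`). Its iterates converge
  uniformly to the unique solution. They stay Borel, because `S⁺[u]` is lower semicontinuous for
  every bounded `u` (`isOpen_lt_supTilt`).
* Probability: whatever the strategies are, `ψ(x_k) 1_Ω(x_k)` decays in the mean like `θ ^ k`, so
  the exit time has finite expectation (`exists_integrable_sum_le`). As a move changes the score by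
  at most `ε`, all scores have a common integrable majorant, and `v(x_k) + s_k` converges to the
  payoff almost surely and in the mean (`tendsto_integral_value`).

If Player I always moves to a point that attains `S⁺[v]` up to the error `η / 2 ^ (k + 1)`, then
`v(x_k) + s_k` loses in the mean at most that much in step `k`, whatever Player II does; hence the
expected payoff is at least `v(x₀) + s₀ - η`, and symmetrically for Player II. Such moves can be
chosen as Borel functions of the position by a Lindelöf argument
(`exists_measurable_supTilt_sub_le`).
-/

noncomputable section

open Filter Topology

namespace TiltedTugOfWar

namespace Setting

variable {n : ℕ} (G : Setting n)

/-! ### The noise law -/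

lemma ρ_nonneg (h : EuclideanSpace ℝ (Fin n)) : 0 ≤ G.ρ h := by
  unfold ρ; positivity

lemma ρ_pos {h : EuclideanSpace ℝ (Fin n)} (hh : ‖h‖ < G.ε) : 0 < G.ρ h := by
  have hr := G.ε_pos
  have hV : 0 < volume.real (Metric.ball (0 : EuclideanSpace ℝ (Fin (n + 1))) G.ε) :=
    ENNReal.toReal_pos (Metric.measure_ball_pos _ _ hr).ne' measure_ball_lt_top.ne
  have hs : 0 < √(G.ε ^ 2 - ‖h‖ ^ 2) :=
    Real.sqrt_pos.2 (by nlinarith [norm_nonneg h])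
  unfold ρ; positivity

lemma setIntegral_mul_ρ (f : EuclideanSpace ℝ (Fin n) → ℝ) :
    ∫ h in Metric.ball (0 : EuclideanSpace ℝ (Fin n)) G.ε, f h * G.ρ h = ∫ h, f h ∂G.noise := by
  rw [noise, integral_withDensity_eq_integral_toReal_smul G.measurable_ρ.ennreal_ofReal
    (by simp)]
  refine integral_congr_ae (.of_forall fun h => ?_)
  simp [ENNReal.toReal_ofReal (G.ρ_nonneg h), mul_comm]

/-- Every nonempty open subset of `B_ε(0)` is charged by the noise. -/
lemma noise_pos_of_isOpen {U : Set (EuclideanSpace ℝ (Fin n))} (hU : IsOpen U)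
    (hne : U.Nonempty) (hsub : U ⊆ Metric.ball 0 G.ε) : 0 < G.noise U := by
  have hac : volume.restrict (Metric.ball (0 : EuclideanSpace ℝ (Fin n)) G.ε) ≪ G.noise := by
    refine withDensity_absolutelyContinuous' G.measurable_ρ.ennreal_ofReal.aemeasurable ?_
    filter_upwards [ae_restrict_mem measurableSet_ball] with h hh
    simpa using G.ρ_pos (by simpa using hh)
  rw [pos_iff_ne_zero]
  intro h0
  have := hac h0
  rw [Measure.restrict_apply hU.measurableSet, Set.inter_eq_left.2 hsub] at this
  exact (hU.measure_pos volume hne).ne' this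

lemma measurable_shift_left (x : G.Pos) : Measurable (G.shift x) :=
  G.measurable_shift.comp measurable_prodMk_left

lemma integrable_comp_shift {u : G.Pos → ℝ} (hu : Measurable u) {C : ℝ} (hC : ∀ x, |u x| ≤ C)
    (x : G.Pos) : Integrable (fun h => u (G.shift x h)) G.noise :=
  .of_bound (hu.comp (G.measurable_shift_left x)).aestronglyMeasurable C
    (.of_forall fun h => by simpa using hC _)

lemma β_pos : 0 < G.β :=
  div_pos (by positivity) (by have := G.two_le_p; positivity)

lemma α_add_β : G.α + G.β = 1 := by
  have h2 := G.two_le_p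
  have : (0 : ℝ) < G.p + n + 1 := by positivity
  unfold α β
  field_simp
  ring

/-! ### The barrier -/

lemma exists_norm_le_of_stripDomain :
    ∃ R : ℝ, ∀ x : G.Pos, ‖(x : EuclideanSpace ℝ (Fin n))‖ ≤ R := by
  obtain ⟨R, hR⟩ := isBounded_iff_forall_norm_le.1 G.isBounded
  refine ⟨R + G.ε + 1, fun ⟨x, hx⟩ => ?_⟩
  have hd : Metric.infDist x G.Ω < G.ε + 1 := by
    rcases hx with hx | hx
    · rw [Metric.infDist_zero_of_mem hx]; linarith [G.ε_pos]
    · linarith [hx.2]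
  obtain ⟨y, hy, hxy⟩ := (Metric.infDist_lt_iff G.nonempty).1 hd
  have := hR y hy
  have h2 := norm_le_norm_add_norm_sub' x y
  rw [← dist_eq_norm] at h2
  change ‖x‖ ≤ _
  linarith

/-- A weight function `ψ` for which the linearised operator, with the tug-of-war moves replaced by
the crude bound `ψ ≤ 1`, is a strict contraction: `ψ(x) = 1 - c exp(λ x₁)` with `λ` so large that
the noise alone makes the exponential grow by a factor of at least `2` in the mean. -/
lemma exists_barrier (hn : 0 < n) : ∃ (ψ : G.Pos → ℝ) (θ : ℝ), Measurable ψ ∧ 0 ≤ θ ∧ θ < 1 ∧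
    (∀ x, 1 / 2 ≤ ψ x) ∧ (∀ x, ψ x ≤ 1) ∧
    ∀ x : G.Pos, (x : EuclideanSpace ℝ (Fin n)) ∈ G.Ω →
      G.α + G.β * ∫ h, ψ (G.shift x h) ∂G.noise ≤ θ * ψ x := by
  have hε := G.ε_pos
  have hβ := G.β_pos
  let i : Fin n := ⟨0, hn⟩
  have hcoord : Continuous fun h : EuclideanSpace ℝ (Fin n) => h i := by fun_prop
  let U : Set (EuclideanSpace ℝ (Fin n)) := Metric.ball 0 G.ε ∩ {h | G.ε / 2 < h i}
  have hU : IsOpen U := Metric.isOpen_ball.inter (isOpen_lt continuous_const hcoord)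
  have hUne : U.Nonempty := by
    refine ⟨EuclideanSpace.single i (3 / 4 * G.ε), ?_, ?_⟩
    · simp [abs_of_pos hε]; linarith
    · simp; linarith
  have hq := G.noise_pos_of_isOpen hU hUne Set.inter_subset_left
  have hq' : 0 < G.noise.real U := ENNReal.toReal_pos hq.ne' (measure_ne_top _ _)
  set q := G.noise.real U with hqdef
  -- `λ` is chosen such that `β q exp(λ ε / 2) ≥ 2`.
  obtain ⟨l, hl0, hl⟩ : ∃ l : ℝ, 0 ≤ l ∧ 2 ≤ G.β * (Real.exp (l * (G.ε / 2)) * q) := by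
    refine ⟨2 / (G.β * q) * (2 / G.ε), by positivity, ?_⟩
    have h1 := Real.add_one_le_exp (2 / (G.β * q))
    have h2 : 2 / (G.β * q) * (2 / G.ε) * (G.ε / 2) = 2 / (G.β * q) := by field_simp
    rw [h2]
    calc (2 : ℝ) = G.β * (2 / (G.β * q) * q) := by field_simp
      _ ≤ _ := by gcongr; linarith
  obtain ⟨R, hR⟩ := G.exists_norm_le_of_stripDomain
  have hxi : ∀ x : G.Pos, |(x : EuclideanSpace ℝ (Fin n)) i| ≤ R := fun x =>
    (PiLp.norm_apply_le (x : EuclideanSpace ℝ (Fin n)) i).trans (hR x)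
  -- The factor `exp(-λ R) / 2` normalises the exponential to be at most `1 / 2` on `Ω_ε`.
  let φ : G.Pos → ℝ := fun x =>
    Real.exp (l * (x : EuclideanSpace ℝ (Fin n)) i) * (Real.exp (-(l * R)) / 2)
  have hφm : Measurable φ := by
    have : Measurable fun x : G.Pos => (x : EuclideanSpace ℝ (Fin n)) i :=
      hcoord.measurable.comp measurable_subtype_coe
    fun_prop
  have hφ0 : ∀ x, 0 < φ x := fun x => by positivity
  have hφle : ∀ x, φ x ≤ 1 / 2 := fun x => by
    have h1 := (abs_le.1 (hxi x)).2
    have h2 : l * (x : EuclideanSpace ℝ (Fin n)) i + -(l * R) ≤ 0 := by nlinarith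
    have h3 := Real.exp_le_one_iff.2 h2
    rw [Real.exp_add] at h3
    simp only [φ]; linarith
  set m := Real.exp (-(l * R)) * (Real.exp (-(l * R)) / 2) with hm
  have hm0 : 0 < m := by positivity
  have hφge : ∀ x, m ≤ φ x := fun x => by
    have h1 := (abs_le.1 (hxi x)).1
    simp only [φ, m]
    gcongr
    nlinarith
  have hφabs : ∀ x, |φ x| ≤ 1 / 2 := fun x => by rw [abs_of_pos (hφ0 x)]; exact hφle x
  -- With `φ ≥ m`, the bound `1 - 2 φ ≤ (1 - m) (1 - φ)` yields the contraction factor `1 - m`.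
  refine ⟨fun x => 1 - φ x, 1 - m, hφm.const_sub 1, ?_, by linarith, fun x => ?_, fun x => ?_,
    fun x hx => ?_⟩
  · obtain ⟨x, hx⟩ := G.nonempty
    linarith [hφge ⟨x, Or.inl hx⟩, hφle ⟨x, Or.inl hx⟩]
  · have := hφle x; simp only; linarith
  · have := hφ0 x; simp only; linarith
  · have hint := G.integrable_comp_shift hφm hφabs x
    have hgrow : 2 * φ x ≤ G.β * ∫ h, φ (G.shift x h) ∂G.noise := by
      have h1 : ∫ h, U.indicator (fun _ => Real.exp (l * (G.ε / 2)) * φ x) h ∂G.noise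
          ≤ ∫ h, φ (G.shift x h) ∂G.noise := by
        refine integral_mono_ae ((integrable_const _).indicator hU.measurableSet) hint ?_
        refine .of_forall fun h => ?_
        by_cases hh : h ∈ U
        · have hlt : ‖h‖ < G.ε := by simpa using hh.1
          have h2 : G.ε / 2 < h i := hh.2
          simp only [Set.indicator_of_mem hh, φ, G.coe_shift hx hlt, PiLp.add_apply]
          rw [mul_add, Real.exp_add, ← mul_assoc, mul_comm (Real.exp (l * (G.ε / 2)))]
          gcongr
        · simpa [hh] using (hφ0 _).le
      rw [integral_indicator_const _ hU.measurableSet, smul_eq_mul] at h1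
      have h2 := mul_le_mul_of_nonneg_left h1 hβ.le
      have h3 := mul_le_mul_of_nonneg_right hl (hφ0 x).le
      refine h3.trans (le_trans (le_of_eq ?_) h2)
      ring
    rw [integral_sub (integrable_const _) hint]
    simp only [integral_const, probReal_univ, smul_eq_mul, mul_one]
    have h1 := hφge x
    have h2 := hφ0 x
    nlinarith [G.α_add_β, mul_pos hm0 h2]

/-! ### The dynamic programming operator -/

lemma tilt_nonneg (x y : G.Pos) : 0 ≤ G.tilt x y := Real.sqrt_nonneg _

lemma tilt_le (x y : G.Pos) : G.tilt x y ≤ G.ε := by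
  unfold tilt
  rw [Real.sqrt_le_left G.ε_pos.le]
  nlinarith [sq_nonneg (dist y x)]

instance (x : G.Pos) : Nonempty {y : G.Pos // dist y x < G.ε} := ⟨⟨x, by simpa using G.ε_pos⟩⟩

variable {G}

lemma bddAbove_supTilt {u : G.Pos → ℝ} {C : ℝ} (hC : ∀ x, |u x| ≤ C) (x : G.Pos) :
    BddAbove (Set.range fun y : {y : G.Pos // dist y x < G.ε} => u y + G.tilt x y) := by
  refine ⟨C + G.ε, ?_⟩
  rintro _ ⟨y, rfl⟩
  have := (abs_le.1 (hC y)).2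
  have := G.tilt_le x y
  simp only; linarith

lemma bddBelow_infTilt {u : G.Pos → ℝ} {C : ℝ} (hC : ∀ x, |u x| ≤ C) (x : G.Pos) :
    BddBelow (Set.range fun y : {y : G.Pos // dist y x < G.ε} => u y - G.tilt x y) := by
  refine ⟨-C - G.ε, ?_⟩
  rintro _ ⟨y, rfl⟩
  have := (abs_le.1 (hC y)).1
  have := G.tilt_le x y
  simp only; linarith

lemma le_supTilt {u : G.Pos → ℝ} {C : ℝ} (hC : ∀ x, |u x| ≤ C) {x y : G.Pos}
    (hy : dist y x < G.ε) : u y + G.tilt x y ≤ G.supTilt u x :=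
  le_ciSup (bddAbove_supTilt hC x) ⟨y, hy⟩

lemma infTilt_le {u : G.Pos → ℝ} {C : ℝ} (hC : ∀ x, |u x| ≤ C) {x y : G.Pos}
    (hy : dist y x < G.ε) : G.infTilt u x ≤ u y - G.tilt x y :=
  ciInf_le (bddBelow_infTilt hC x) ⟨y, hy⟩

lemma lt_supTilt_iff {u : G.Pos → ℝ} {C : ℝ} (hC : ∀ x, |u x| ≤ C) {x : G.Pos} {a : ℝ} :
    a < G.supTilt u x ↔ ∃ y, dist y x < G.ε ∧ a < u y + G.tilt x y := by
  rw [supTilt, lt_ciSup_iff (bddAbove_supTilt hC x)]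
  simp

lemma infTilt_eq_neg_supTilt_neg (u : G.Pos → ℝ) (x : G.Pos) :
    G.infTilt u x = -G.supTilt (-u) x := by
  rw [supTilt, infTilt, iInf, iSup, Real.sInf_def, Set.neg_range]
  congr! 3
  ext y
  simp [sub_eq_add_neg, add_comm]

lemma supTilt_le_add {u w : G.Pos → ℝ} {C D : ℝ} (hC : ∀ x, |w x| ≤ C)
    (h : ∀ x, u x ≤ w x + D) (x : G.Pos) : G.supTilt u x ≤ G.supTilt w x + D := by
  refine ciSup_le fun y => ?_
  have := le_supTilt hC y.2
  linarith [h y]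

lemma abs_supTilt_sub_le {u w : G.Pos → ℝ} {C C' D : ℝ} (hC : ∀ x, |u x| ≤ C)
    (hC' : ∀ x, |w x| ≤ C') (h : ∀ x, |u x - w x| ≤ D) (x : G.Pos) :
    |G.supTilt u x - G.supTilt w x| ≤ D := by
  have h1 := supTilt_le_add hC' (fun x => by linarith [(abs_le.1 (h x)).2] : ∀ x, u x ≤ w x + D) x
  have h2 := supTilt_le_add hC (fun x => by linarith [(abs_le.1 (h x)).1] : ∀ x, w x ≤ u x + D) x
  exact abs_le.2 ⟨by linarith, by linarith⟩

lemma abs_infTilt_sub_le {u w : G.Pos → ℝ} {C C' D : ℝ} (hC : ∀ x, |u x| ≤ C)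
    (hC' : ∀ x, |w x| ≤ C') (h : ∀ x, |u x - w x| ≤ D) (x : G.Pos) :
    |G.infTilt u x - G.infTilt w x| ≤ D := by
  have := abs_supTilt_sub_le (u := -u) (w := -w) (by simpa using hC) (by simpa using hC')
    (D := D) (fun x => by simpa [abs_sub_comm, neg_add_eq_sub] using h x) x
  rw [infTilt_eq_neg_supTilt_neg, infTilt_eq_neg_supTilt_neg, ← abs_neg]
  convert this using 2
  ring

lemma abs_supTilt_le {u : G.Pos → ℝ} {C : ℝ} (hC : ∀ x, |u x| ≤ C) (x : G.Pos) :
    |G.supTilt u x| ≤ C + G.ε := by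
  have h1 : u x + G.tilt x x ≤ G.supTilt u x := le_supTilt hC (by simpa using G.ε_pos)
  have h2 : G.supTilt u x ≤ C + G.ε := ciSup_le fun y => by
    linarith [(abs_le.1 (hC y)).2, G.tilt_le x y]
  exact abs_le.2 ⟨by linarith [(abs_le.1 (hC x)).1, G.tilt_nonneg x x, G.ε_pos], h2⟩

lemma abs_infTilt_le {u : G.Pos → ℝ} {C : ℝ} (hC : ∀ x, |u x| ≤ C) (x : G.Pos) :
    |G.infTilt u x| ≤ C + G.ε := by
  rw [infTilt_eq_neg_supTilt_neg, abs_neg]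
  exact abs_supTilt_le (by simpa using hC) x

/-- `S⁺[u]` is lower semicontinuous for bounded `u`, whatever the regularity of `u`. -/
lemma isOpen_lt_supTilt {u : G.Pos → ℝ} {C : ℝ} (hC : ∀ x, |u x| ≤ C) (a : ℝ) :
    IsOpen {x | a < G.supTilt u x} := by
  have : {x | a < G.supTilt u x} =
      ⋃ y, {x | dist y x < G.ε ∧ a < u y + G.tilt x y} := by
    ext x; simp [lt_supTilt_iff hC]
  rw [this]
  refine isOpen_iUnion fun y => ?_
  have hc : Continuous fun x => u y + G.tilt x y := by unfold tilt; fun_prop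
  exact (isOpen_lt (continuous_const.dist continuous_id) continuous_const).inter
    (isOpen_lt continuous_const hc)

lemma measurable_supTilt {u : G.Pos → ℝ} {C : ℝ} (hC : ∀ x, |u x| ≤ C) :
    Measurable (G.supTilt u) :=
  measurable_of_Ioi fun a => (isOpen_lt_supTilt hC a).measurableSet

lemma measurable_infTilt {u : G.Pos → ℝ} {C : ℝ} (hC : ∀ x, |u x| ≤ C) :
    Measurable (G.infTilt u) := by
  have : G.infTilt u = fun x => -G.supTilt (-u) x := funext (infTilt_eq_neg_supTilt_neg u)
  rw [this]
  exact (measurable_supTilt (u := -u) (by simpa using hC)).neg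

variable (G)

open Classical in
/-- The dynamic programming operator with boundary values `F`. -/
def dppOp (F : G.strip → ℝ) (u : G.Pos → ℝ) (x : G.Pos) : ℝ :=
  if hx : (x : EuclideanSpace ℝ (Fin n)) ∈ G.Ω then
    G.α / 2 * (G.supTilt u x + G.infTilt u x) + G.β * ∫ h, u (G.shift x h) ∂G.noise
  else F ⟨x, x.2.resolve_left hx⟩

variable {G}

lemma isSolution_iff {F : G.strip → ℝ} {v : G.Pos → ℝ} :
    G.IsSolution F v ↔ Measurable v ∧ (∃ C, ∀ x, |v x| ≤ C) ∧ G.dppOp F v = v := by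
  constructor
  · rintro ⟨h1, h2, h3, h4⟩
    refine ⟨h1, h2, funext fun x => ?_⟩
    unfold dppOp
    split_ifs with hx
    · rw [h4 x hx, setIntegral_mul_ρ]
    · exact (h3 ⟨x, x.2.resolve_left hx⟩).symm
  · rintro ⟨h1, h2, h3⟩
    refine ⟨h1, h2, fun x => ?_, fun x hx => ?_⟩
    · rw [← h3, dppOp, dif_neg x.2.1]
    · rw [setIntegral_mul_ρ]
      conv_lhs => rw [← h3, dppOp, dif_pos hx]

lemma measurable_dppOp {F : G.strip → ℝ} (hF : Measurable F) {u : G.Pos → ℝ} (hu : Measurable u)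
    {C : ℝ} (hC : ∀ x, |u x| ≤ C) : Measurable (G.dppOp F u) := by
  classical
  have hint : Measurable fun x => ∫ h, u (G.shift x h) ∂G.noise :=
    (hu.comp G.measurable_shift).stronglyMeasurable.integral_prod_right'.measurable
  have h1 : Measurable fun x => G.α / 2 * (G.supTilt u x + G.infTilt u x)
      + G.β * ∫ h, u (G.shift x h) ∂G.noise :=
    (((measurable_supTilt hC).add (measurable_infTilt hC)).const_mul _).add (hint.const_mul _)
  have hΩ : MeasurableSet {x : G.Pos | (x : EuclideanSpace ℝ (Fin n)) ∈ G.Ω} :=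
    measurable_subtype_coe G.isOpen.measurableSet
  have h2 : Measurable
      fun x : ({x : G.Pos | (x : EuclideanSpace ℝ (Fin n)) ∈ G.Ω}ᶜ : Set G.Pos) =>
        F ⟨x.1, x.1.2.resolve_left x.2⟩ :=
    hF.comp (Measurable.subtype_mk (measurable_subtype_coe.comp measurable_subtype_coe))
  exact Measurable.dite (h1.comp measurable_subtype_coe) h2 hΩ

lemma abs_dppOp_le {F : G.strip → ℝ} {u : G.Pos → ℝ} {C : ℝ} (hF : ∀ x, |F x| ≤ C)
    (hC : ∀ x, |u x| ≤ C) (x : G.Pos) : |G.dppOp F u x| ≤ C + G.ε := by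
  have hε := G.ε_pos
  unfold dppOp
  split_ifs with hx
  · have h1 := abs_le.1 (abs_supTilt_le hC x)
    have h2 := abs_le.1 (abs_infTilt_le hC x)
    have h3 : |∫ h, u (G.shift x h) ∂G.noise| ≤ C := by
      simpa using norm_integral_le_of_norm_le_const (μ := G.noise)
        (f := fun h => u (G.shift x h)) (.of_forall fun h => by simpa using hC _)
    have h4 := abs_le.1 h3
    have hα := G.α_nonneg
    have hβ := G.β_nonneg
    have hs := G.α_add_β
    rw [abs_le]
    constructor <;> nlinarith
  · linarith [hF ⟨x, x.2.resolve_left hx⟩]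

/-- The dynamic programming operator is a contraction with factor `θ` in the norm weighted by the
barrier `ψ`. -/
lemma abs_dppOp_sub_le {ψ : G.Pos → ℝ} {θ : ℝ} (hψm : Measurable ψ) (hψ : ∀ x, 1 / 2 ≤ ψ x)
    (hψ' : ∀ x, ψ x ≤ 1) (hθ : 0 ≤ θ)
    (hψθ : ∀ x : G.Pos, (x : EuclideanSpace ℝ (Fin n)) ∈ G.Ω →
      G.α + G.β * ∫ h, ψ (G.shift x h) ∂G.noise ≤ θ * ψ x)
    (F : G.strip → ℝ) {u w : G.Pos → ℝ} (hu : Measurable u) (hw : Measurable w)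
    {C C' D : ℝ} (hC : ∀ x, |u x| ≤ C) (hC' : ∀ x, |w x| ≤ C') (hD : 0 ≤ D)
    (h : ∀ x, |u x - w x| ≤ D * ψ x) (x : G.Pos) :
    |G.dppOp F u x - G.dppOp F w x| ≤ D * θ * ψ x := by
  have hψ0 : 0 ≤ ψ x := by linarith [hψ x]
  unfold dppOp
  split_ifs with hx
  · have hle : ∀ x, |u x - w x| ≤ D := fun x =>
      (h x).trans (mul_le_of_le_one_right hD (hψ' x))
    have h1 := abs_le.1 (abs_supTilt_sub_le hC hC' hle x)
    have h2 := abs_le.1 (abs_infTilt_sub_le hC hC' hle x)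
    have iu := G.integrable_comp_shift hu hC x
    have iw := G.integrable_comp_shift hw hC' x
    have iψ := G.integrable_comp_shift hψm (C := 1)
      (fun x => by rw [abs_of_nonneg (by linarith [hψ x])]; exact hψ' x) x
    have h3 : |∫ h, u (G.shift x h) ∂G.noise - ∫ h, w (G.shift x h) ∂G.noise|
        ≤ D * ∫ h, ψ (G.shift x h) ∂G.noise := by
      rw [← integral_sub iu iw, ← integral_const_mul]
      exact norm_integral_le_of_norm_le (f := fun z => u (G.shift x z) - w (G.shift x z))
        (iψ.const_mul D) (.of_forall fun z => h _)
    have h4 := abs_le.1 h3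
    have hα := G.α_nonneg
    have hβ := G.β_nonneg
    have h5 := mul_le_mul_of_nonneg_left (hψθ x hx) hD
    rw [abs_le]
    constructor <;> nlinarith
  · simpa using by positivity

/-- Existence of the fixed point, as the limit of the iterates of the dynamic programming
operator. -/
lemma exists_isSolution (hn : 0 < n) {F : G.strip → ℝ} (hF : Measurable F)
    (hFb : ∃ C, ∀ x, |F x| ≤ C) : ∃ v, G.IsSolution F v := by
  obtain ⟨ψ, θ, hψm, hθ, hθ1, hψ, hψ', hψθ⟩ := G.exists_barrier hn
  obtain ⟨C, hC⟩ := hFb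
  let u : ℕ → G.Pos → ℝ := fun k => (G.dppOp F)^[k] 0
  have hsucc : ∀ k, u (k + 1) = G.dppOp F (u k) := fun k => Function.iterate_succ_apply' _ _ _
  have hu : ∀ k, Measurable (u k) ∧ ∃ B, ∀ x, |u k x| ≤ B := by
    intro k
    induction k with
    | zero => exact ⟨measurable_const, 0, by simp [u]⟩
    | succ k ih =>
      obtain ⟨hm, B, hB⟩ := ih
      rw [hsucc]
      exact ⟨measurable_dppOp hF hm hB, _, abs_dppOp_le (C := max B C)
        (fun x => (hC x).trans (le_max_right _ _)) (fun x => (hB x).trans (le_max_left _ _))⟩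
  obtain ⟨B, hB⟩ := (hu 1).2
  have hB0 : 0 ≤ B := by
    obtain ⟨x, hx⟩ := G.nonempty
    exact (abs_nonneg _).trans (hB ⟨x, Or.inl hx⟩)
  have hstep : ∀ k x, |u k x - u (k + 1) x| ≤ 2 * B * θ ^ k * ψ x := by
    intro k
    induction k with
    | zero =>
      intro x
      have h1 : u 0 x = 0 := rfl
      rw [h1, zero_sub, abs_neg]
      nlinarith [hB x, hψ x]
    | succ k ih =>
      intro x
      have := abs_dppOp_sub_le hψm hψ hψ' hθ hψθ F (hu k).1 (hu (k + 1)).1 (hu k).2.choose_spec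
        (hu (k + 1)).2.choose_spec (by positivity) ih x
      rw [← hsucc, ← hsucc] at this
      rwa [pow_succ, ← mul_assoc]
  have hgeom : ∀ x k, dist (u k x) (u (k + 1) x) ≤ 2 * B * θ ^ k := fun x k => by
    rw [Real.dist_eq]
    exact (hstep k x).trans (mul_le_of_le_one_right (by positivity) (hψ' x))
  have hlim : ∀ x, ∃ a, Tendsto (fun k => u k x) atTop (𝓝 a) := fun x =>
    cauchySeq_tendsto_of_complete (cauchySeq_of_le_geometric θ (2 * B) hθ1 (hgeom x))
  choose v hv using hlim
  have hvm : Measurable v :=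
    measurable_of_tendsto_metrizable (fun k => (hu k).1) (tendsto_pi_nhds.2 hv)
  have herr : ∀ k x, |u k x - v x| ≤ 2 * B * θ ^ k / (1 - θ) := fun k x =>
    dist_le_of_le_geometric_of_tendsto θ (2 * B) hθ1 (hgeom x) (hv x) k
  have hvb : ∀ x, |v x| ≤ 2 * B / (1 - θ) := fun x => by
    have := herr 0 x
    have h1 : u 0 x = 0 := rfl
    simpa [h1] using this
  refine ⟨v, isSolution_iff.2 ⟨hvm, ⟨_, hvb⟩, funext fun x => ?_⟩⟩
  refine tendsto_nhds_unique (f := fun k => u (k + 1) x) ?_ ((tendsto_add_atTop_iff_nat 1).2 (hv x))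
  rw [tendsto_iff_dist_tendsto_zero]
  have hθ' : 0 < 1 - θ := by linarith
  have hz : Tendsto (fun k : ℕ => 4 * B * θ ^ k / (1 - θ)) atTop (𝓝 0) := by
    simpa using ((tendsto_pow_atTop_nhds_zero_of_lt_one hθ hθ1).const_mul (4 * B)).div_const (1 - θ)
  refine squeeze_zero (fun _ => dist_nonneg) (fun k => ?_) hz
  rw [Real.dist_eq, hsucc]
  have hD : ∀ x, |u k x - v x| ≤ 4 * B * θ ^ k / (1 - θ) * ψ x := fun x => by
    refine (herr k x).trans ?_
    calc 2 * B * θ ^ k / (1 - θ) = 4 * B * θ ^ k / (1 - θ) * (1 / 2) := by ring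
      _ ≤ _ := by gcongr; exact hψ x
  have h1 := abs_dppOp_sub_le hψm hψ hψ' hθ hψθ F (hu k).1 hvm (hu k).2.choose_spec hvb
    (by positivity) hD x
  refine h1.trans ?_
  rw [mul_assoc]
  exact mul_le_of_le_one_right (by positivity)
    (mul_le_one₀ hθ1.le (by linarith [hψ x]) (hψ' x))

lemma IsSolution.eq (hn : 0 < n) {F : G.strip → ℝ} {v w : G.Pos → ℝ} (hv : G.IsSolution F v)
    (hw : G.IsSolution F w) : w = v := by
  obtain ⟨ψ, θ, hψm, hθ, hθ1, hψ, hψ', hψθ⟩ := G.exists_barrier hn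
  obtain ⟨hvm, ⟨B, hB⟩, hvT⟩ := isSolution_iff.1 hv
  obtain ⟨hwm, ⟨C, hC⟩, hwT⟩ := isSolution_iff.1 hw
  have hBC : 0 ≤ B + C := by
    obtain ⟨x, hx⟩ := G.nonempty
    have h1 := (abs_nonneg _).trans (hB ⟨x, Or.inl hx⟩)
    have h2 := (abs_nonneg _).trans (hC ⟨x, Or.inl hx⟩)
    linarith
  have key : ∀ (k : ℕ) x, |w x - v x| ≤ 2 * (B + C) * θ ^ k * ψ x := by
    intro k
    induction k with
    | zero =>
      intro x
      have := abs_sub (w x) (v x)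
      nlinarith [hB x, hC x, hψ x]
    | succ k ih =>
      intro x
      have := abs_dppOp_sub_le hψm hψ hψ' hθ hψθ F hwm hvm hC hB (by positivity) ih x
      rw [hvT, hwT] at this
      rwa [pow_succ, ← mul_assoc]
  funext x
  have hz : Tendsto (fun k : ℕ => 2 * (B + C) * θ ^ k * ψ x) atTop (𝓝 0) := by
    simpa using ((tendsto_pow_atTop_nhds_zero_of_lt_one hθ hθ1).const_mul
      (2 * (B + C))).mul_const (ψ x)
  have := ge_of_tendsto' hz fun k => key k x
  exact sub_eq_zero.1 (abs_nonpos_iff.1 this)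

/-! ### Measurable almost optimal moves -/

/-- A Borel selection of almost maximising moves. Since the superlevel sets of `S⁺[u]` are unions of
the open sets `{x : |y - x| < ε, u(y) + √(ε² - |y - x|²) > q}`, the Lindelöf property yields
countably many points `y` which suffice to compute `S⁺[u]` everywhere; the first almost optimal one
in an enumeration is a Borel function of `x`. -/
lemma exists_measurable_supTilt_sub_le {u : G.Pos → ℝ} {C : ℝ} (hC : ∀ x, |u x| ≤ C) {η : ℝ}
    (hη : 0 < η) : ∃ f : G.Pos → G.Pos, Measurable f ∧ ∀ x, dist (f x) x < G.ε ∧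
      G.supTilt u x - η ≤ u (f x) + G.tilt x (f x) := by
  classical
  let O : ℚ → G.Pos → Set G.Pos := fun q y => {x | dist y x < G.ε ∧ (q : ℝ) < u y + G.tilt x y}
  have hO : ∀ q y, IsOpen (O q y) := fun q y => by
    have hc : Continuous fun x => u y + G.tilt x y := by unfold tilt; fun_prop
    exact (isOpen_lt (continuous_const.dist continuous_id) continuous_const).inter
      (isOpen_lt continuous_const hc)
  choose T hTc hT using fun q => TopologicalSpace.isOpen_iUnion_countable (O q) (hO q)
  obtain ⟨z, hz⟩ := G.nonempty
  let D : Set G.Pos := insert ⟨z, Or.inl hz⟩ (⋃ q, T q)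
  have hDc : D.Countable := (Set.countable_iUnion hTc).insert _
  obtain ⟨y, hy⟩ := hDc.exists_eq_range ⟨_, Set.mem_insert _ _⟩
  have hex : ∀ x, ∃ k, dist (y k) x < G.ε ∧ G.supTilt u x - η ≤ u (y k) + G.tilt x (y k) := by
    intro x
    obtain ⟨q, hq1, hq2⟩ := exists_rat_btwn (sub_lt_self (G.supTilt u x) hη)
    obtain ⟨w, hw1, hw2⟩ := (lt_supTilt_iff hC).1 hq2
    have hx : x ∈ ⋃ i ∈ T q, O q i := by
      rw [hT]; exact Set.mem_iUnion.2 ⟨w, hw1, hw2⟩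
    obtain ⟨w', hw', hxw⟩ := Set.mem_iUnion₂.1 hx
    have hD : w' ∈ D := Set.mem_insert_of_mem _ (Set.mem_iUnion.2 ⟨q, hw'⟩)
    rw [hy] at hD
    obtain ⟨k, rfl⟩ := hD
    exact ⟨k, hxw.1, (hq1.trans hxw.2).le⟩
  have hS := measurable_supTilt hC
  have hp : ∀ k, MeasurableSet {x | dist (y k) x < G.ε ∧
      G.supTilt u x - η ≤ u (y k) + G.tilt x (y k)} := fun k => by
    have hc : Continuous fun x => u (y k) + G.tilt x (y k) := by unfold tilt; fun_prop
    exact (measurableSet_lt (continuous_const.dist continuous_id).measurable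
      measurable_const).inter (measurableSet_le (hS.sub_const η) hc.measurable)
  exact ⟨fun x => y (Nat.find (hex x)), Measurable.find (f := fun k _ => y k)
    (fun k => measurable_const) hp hex, fun x => Nat.find_spec (hex x)⟩

lemma exists_measurable_le_infTilt_add {u : G.Pos → ℝ} {C : ℝ} (hC : ∀ x, |u x| ≤ C) {η : ℝ}
    (hη : 0 < η) : ∃ f : G.Pos → G.Pos, Measurable f ∧ ∀ x, dist (f x) x < G.ε ∧
      u (f x) - G.tilt x (f x) ≤ G.infTilt u x + η := by
  obtain ⟨f, hf, h⟩ := exists_measurable_supTilt_sub_le (u := -u) (by simpa using hC) hη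
  refine ⟨f, hf, fun x => ⟨(h x).1, ?_⟩⟩
  have := (h x).2
  rw [infTilt_eq_neg_supTilt_neg]
  simp only [Pi.neg_apply] at this
  linarith

/-- The strategy that plays the map `f k` of the current position at time `k`. -/
def markovStrategy (f : ℕ → G.Pos → G.Pos) (hf : ∀ k, Measurable (f k))
    (hd : ∀ k x, dist (f k x) x < G.ε) : G.Strategy where
  move k h := f k (G.last h).1
  measurable k := (hf k).comp (measurable_fst.comp (G.measurable_last k))
  admissible k _ _ := hd k _

/-! ### One step of the game -/

lemma stepLaw_of_notMem (S₁ S₂ : G.Strategy) {k : ℕ} {h : G.History k}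
    (hx : ((G.last h).1 : EuclideanSpace ℝ (Fin n)) ∉ G.Ω) :
    G.stepLaw S₁ S₂ k h = Measure.dirac (G.last h) := by
  unfold stepLaw; exact if_neg hx

lemma measurable_shift_prodMk (a : G.State) :
    Measurable fun z => (G.shift a.1 z, a.2) :=
  (G.measurable_shift_left a.1).prodMk measurable_const

lemma integral_stepLaw (S₁ S₂ : G.Strategy) {k : ℕ} {h : G.History k}
    (hx : ((G.last h).1 : EuclideanSpace ℝ (Fin n)) ∈ G.Ω) {g : G.State → ℝ} (hg : Measurable g)
    (hi : Integrable (fun z => g (G.shift (G.last h).1 z, (G.last h).2)) G.noise) :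
    ∫ y, g y ∂(G.stepLaw S₁ S₂ k h) =
      G.β * ∫ z, g (G.shift (G.last h).1 z, (G.last h).2) ∂G.noise
      + G.α / 2 * g (S₁.move k h, (G.last h).2 + G.tilt (G.last h).1 (S₁.move k h))
      + G.α / 2 * g (S₂.move k h, (G.last h).2 - G.tilt (G.last h).1 (S₂.move k h)) := by
  have hm := measurable_shift_prodMk (G.last h)
  have i0 : Integrable g (G.noise.map fun z => (G.shift (G.last h).1 z, (G.last h).2)) :=
    (integrable_map_measure hg.aestronglyMeasurable hm.aemeasurable).2 hi
  have id : ∀ a : G.State, Integrable g (Measure.dirac a) := fun a =>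
    integrable_dirac' hg.stronglyMeasurable (by simp)
  have hα : 0 ≤ G.α / 2 := by linarith [G.α_nonneg]
  unfold stepLaw
  rw [if_pos hx, integral_add_measure, integral_add_measure, integral_smul_measure,
    integral_smul_measure, integral_smul_measure, integral_dirac, integral_dirac,
    integral_map hm.aemeasurable hg.aestronglyMeasurable, ENNReal.toReal_ofReal G.β_nonneg,
    ENNReal.toReal_ofReal hα]
  · rfl
  · exact i0.smul_measure (by simp)
  · exact (id _).smul_measure (by simp)
  · exact (i0.smul_measure (by simp)).add_measure ((id _).smul_measure (by simp))
  · exact (id _).smul_measure (by simp)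

/-- In one step the score changes by at most `ε`, and not at all (nor does the position) once the
strip is reached. -/
lemma ae_stepLaw (S₁ S₂ : G.Strategy) (k : ℕ) (h : G.History k) :
    ∀ᵐ y ∂(G.stepLaw S₁ S₂ k h), |y.2 - (G.last h).2| ≤ G.ε ∧
      (((G.last h).1 : EuclideanSpace ℝ (Fin n)) ∉ G.Ω → y = G.last h) := by
  have hε := G.ε_pos.le
  by_cases hx : ((G.last h).1 : EuclideanSpace ℝ (Fin n)) ∈ G.Ω
  · have hms : MeasurableSet {y : G.State | |y.2 - (G.last h).2| ≤ G.ε} :=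
      measurableSet_le (by fun_prop) measurable_const
    have ht := fun y => G.tilt_nonneg (G.last h).1 y
    have ht' := fun y => G.tilt_le (G.last h).1 y
    simp only [hx, not_true_eq_false, false_imp_iff, and_true]
    unfold stepLaw
    rw [if_pos hx, ae_add_measure_iff, ae_add_measure_iff]
    refine ⟨⟨Measure.ae_smul_measure ?_ _, Measure.ae_smul_measure ?_ _⟩,
      Measure.ae_smul_measure ?_ _⟩
    · rw [ae_map_iff (measurable_shift_prodMk _).aemeasurable hms]
      simpa using hε
    · rw [ae_dirac_iff hms]
      simpa [abs_of_nonneg (ht _)] using ht' _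
    · rw [ae_dirac_iff hms]
      simpa [abs_of_nonneg (ht _)] using ht' _
  · rw [stepLaw_of_notMem S₁ S₂ hx, ae_dirac_eq]
    simpa using hε

/-! ### The law of the game -/

instance (S₁ S₂ : G.Strategy) (a : G.State) : IsProbabilityMeasure (G.law S₁ S₂ a) := by
  unfold law; infer_instance

lemma map_law_succ (S₁ S₂ : G.Strategy) (a : G.State) (k : ℕ) :
    (G.law S₁ S₂ a).map (fun ω => (Preorder.frestrictLe k ω, ω (k + 1))) =
      (G.law S₁ S₂ a).map (Preorder.frestrictLe k) ⊗ₘ G.stepKernel S₁ S₂ k := by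
  unfold law
  rw [Kernel.traj_map_frestrictLe_apply]
  exact (Kernel.partialTraj_compProd_eq_map_traj (X := fun _ => G.State) k.zero_le).symm

lemma ae_law_zero (S₁ S₂ : G.Strategy) (a : G.State) : ∀ᵐ ω ∂(G.law S₁ S₂ a), ω 0 = a := by
  have h : (G.law S₁ S₂ a).map (Preorder.frestrictLe 0) = Measure.dirac fun _ => a := by
    unfold law
    rw [Kernel.traj_map_frestrictLe_apply, Kernel.partialTraj_self, Kernel.id_apply]
  have h2 : ∀ᵐ x ∂(G.law S₁ S₂ a).map (Preorder.frestrictLe 0), G.last (k := 0) x = a := by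
    rw [h]
    exact (ae_dirac_iff (G.measurable_last 0 (measurableSet_singleton a))).2 rfl
  exact ae_of_ae_map (Preorder.measurable_frestrictLe 0).aemeasurable h2

lemma ae_law_succ (S₁ S₂ : G.Strategy) (a : G.State) :
    ∀ᵐ ω ∂(G.law S₁ S₂ a), ∀ k, |(ω (k + 1)).2 - (ω k).2| ≤ G.ε ∧
      (((ω k).1 : EuclideanSpace ℝ (Fin n)) ∉ G.Ω → ω (k + 1) = ω k) := by
  rw [ae_all_iff]
  intro k
  have hl := G.measurable_last k
  have hms : MeasurableSet {q : G.History k × G.State | |q.2.2 - (G.last q.1).2| ≤ G.ε ∧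
      (((G.last q.1).1 : EuclideanSpace ℝ (Fin n)) ∉ G.Ω → q.2 = G.last q.1)} := by
    have hd : Measurable fun q : G.History k × G.State => |q.2.2 - (G.last q.1).2| := by fun_prop
    refine (measurableSet_le hd measurable_const).inter ?_
    refine MeasurableSet.imp ?_ (measurableSet_eq_fun (by fun_prop) (by fun_prop))
    exact ((measurable_subtype_coe.comp (measurable_fst.comp (hl.comp measurable_fst)))
      G.isOpen.measurableSet).compl
  have h := Measure.ae_compProd_of_ae_ae (μ := (G.law S₁ S₂ a).map (Preorder.frestrictLe k))
    (κ := G.stepKernel S₁ S₂ k) hms (.of_forall fun h => ae_stepLaw S₁ S₂ k h)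
  rw [← map_law_succ] at h
  exact ae_of_ae_map (f := fun ω : ℕ → G.State => (Preorder.frestrictLe k ω, ω (k + 1)))
    (by fun_prop) h

lemma integral_law_succ (S₁ S₂ : G.Strategy) (a : G.State) (k : ℕ) {g : G.State → ℝ}
    (hg : Measurable g) (hi : Integrable (fun ω => g (ω (k + 1))) (G.law S₁ S₂ a)) :
    Integrable (fun ω => ∫ y, g y ∂(G.stepLaw S₁ S₂ k (Preorder.frestrictLe k ω)))
      (G.law S₁ S₂ a) ∧
    ∫ ω, g (ω (k + 1)) ∂(G.law S₁ S₂ a) =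
      ∫ ω, ∫ y, g y ∂(G.stepLaw S₁ S₂ k (Preorder.frestrictLe k ω)) ∂(G.law S₁ S₂ a) := by
  have hm : Measurable fun ω : ℕ → G.State => (Preorder.frestrictLe k ω, ω (k + 1)) := by fun_prop
  have hg2 : Measurable fun q : G.History k × G.State => g q.2 := hg.comp measurable_snd
  have hi2 : Integrable (fun q : G.History k × G.State => g q.2)
      ((G.law S₁ S₂ a).map (Preorder.frestrictLe k) ⊗ₘ G.stepKernel S₁ S₂ k) := by
    rw [← map_law_succ, integrable_map_measure hg2.aestronglyMeasurable hm.aemeasurable]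
    exact hi
  have hr : Measurable (Preorder.frestrictLe (π := fun _ => G.State) k) :=
    Preorder.measurable_frestrictLe k
  have hi3 : Integrable (fun h => ∫ y, g y ∂(G.stepKernel S₁ S₂ k h))
      ((G.law S₁ S₂ a).map (Preorder.frestrictLe k)) :=
    Integrable.integral_compProd (κ := Kernel.const Unit _)
      (η := Kernel.prodMkLeft Unit (G.stepKernel S₁ S₂ k)) (a := ()) hi2
  constructor
  · exact (integrable_map_measure hi3.aestronglyMeasurable hr.aemeasurable).1 hi3
  · have h1 : ∫ ω, g (ω (k + 1)) ∂(G.law S₁ S₂ a) = ∫ q : G.History k × G.State, g q.2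
        ∂(G.law S₁ S₂ a).map (fun ω => (Preorder.frestrictLe k ω, ω (k + 1))) :=
      (integral_map hm.aemeasurable hg2.aestronglyMeasurable).symm
    rw [h1, map_law_succ, Measure.integral_compProd hi2]
    exact integral_map hr.aemeasurable hi3.aestronglyMeasurable

/-! ### The exit time -/

open Classical in
/-- Up to a null set, the number of steps started in `Ω` is dominated by an integrable function.
The barrier, evaluated along the game and killed in the strip, decays geometrically in the mean, and
it is at least `1/2` in `Ω`. -/
lemma exists_integrable_sum_le (hn : 0 < n) (S₁ S₂ : G.Strategy) (a : G.State) :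
    ∃ N : (ℕ → G.State) → ℝ, Integrable N (G.law S₁ S₂ a) ∧
      ∀ᵐ ω ∂(G.law S₁ S₂ a), ∀ k, ∑ j ∈ Finset.range k,
        (if ((ω j).1 : EuclideanSpace ℝ (Fin n)) ∈ G.Ω then (1 : ℝ) else 0) ≤ N ω := by
  obtain ⟨ψ, θ, hψm, hθ, hθ1, hψ, hψ', hψθ⟩ := G.exists_barrier hn
  let φ : G.State → ℝ := fun y => if (y.1 : EuclideanSpace ℝ (Fin n)) ∈ G.Ω then ψ y.1 else 0
  have hφm : Measurable φ :=
    Measurable.ite ((measurable_subtype_coe.comp measurable_fst) G.isOpen.measurableSet)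
      (hψm.comp measurable_fst) measurable_const
  have hφ0 : ∀ y, 0 ≤ φ y := fun y => by
    simp only [φ]; split_ifs
    · linarith [hψ y.1]
    · exact le_rfl
  have hφψ : ∀ y, φ y ≤ ψ y.1 := fun y => by
    simp only [φ]; split_ifs
    · exact le_rfl
    · linarith [hψ y.1]
  have hφ1 : ∀ y, φ y ≤ 1 := fun y => (hφψ y).trans (hψ' _)
  have hstep : ∀ k (h : G.History k), ∫ y, φ y ∂(G.stepLaw S₁ S₂ k h) ≤ θ * φ (G.last h) := by
    intro k h
    by_cases hx : ((G.last h).1 : EuclideanSpace ℝ (Fin n)) ∈ G.Ω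
    · have iψ := G.integrable_comp_shift hψm (C := 1)
        (fun x => by rw [abs_of_nonneg (by linarith [hψ x])]; exact hψ' x) (G.last h).1
      have iφ : Integrable (fun z => φ (G.shift (G.last h).1 z, (G.last h).2)) G.noise :=
        .of_bound (hφm.comp (measurable_shift_prodMk _)).aestronglyMeasurable 1
          (.of_forall fun z => by rw [Real.norm_of_nonneg (hφ0 _)]; exact hφ1 _)
      rw [integral_stepLaw S₁ S₂ hx hφm iφ]
      have h1 : φ (G.last h) = ψ (G.last h).1 := if_pos hx
      rw [h1]
      have h2 := integral_mono iφ iψ fun z => hφψ _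
      have h3 := mul_le_mul_of_nonneg_left h2 G.β_nonneg
      have hα : 0 ≤ G.α / 2 := by linarith [G.α_nonneg]
      have h4 := fun y => mul_le_of_le_one_right hα (hφ1 y)
      linarith [h4 (S₁.move k h, (G.last h).2 + G.tilt (G.last h).1 (S₁.move k h)),
        h4 (S₂.move k h, (G.last h).2 - G.tilt (G.last h).1 (S₂.move k h)), hψθ _ hx]
    · rw [stepLaw_of_notMem S₁ S₂ hx, integral_dirac]
      simp [φ, hx]
  have hφk : ∀ k, Measurable fun ω : ℕ → G.State => φ (ω k) := fun k =>
    hφm.comp (measurable_pi_apply k)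
  have hi : ∀ k, Integrable (fun ω => φ (ω k)) (G.law S₁ S₂ a) := fun k =>
    .of_bound (hφk k).aestronglyMeasurable 1
      (.of_forall fun z => by rw [Real.norm_of_nonneg (hφ0 _)]; exact hφ1 _)
  have hdecay : ∀ k, ∫ ω, φ (ω k) ∂(G.law S₁ S₂ a) ≤ θ ^ k := by
    intro k
    induction k with
    | zero =>
      simpa using integral_mono (hi 0) (integrable_const 1) fun ω => hφ1 _
    | succ k ih =>
      obtain ⟨h1, h2⟩ := integral_law_succ S₁ S₂ a k hφm (hi (k + 1))
      rw [h2, pow_succ, mul_comm]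
      refine (integral_mono h1 ((hi k).const_mul θ) fun ω => hstep k _).trans ?_
      rw [integral_const_mul]
      exact mul_le_mul_of_nonneg_left ih hθ
  let M : (ℕ → G.State) → ENNReal := fun ω => ∑' k, ENNReal.ofReal (φ (ω k))
  have hMm : Measurable M := Measurable.tsum fun k => (hφk k).ennreal_ofReal
  have hM : ∫⁻ ω, M ω ∂(G.law S₁ S₂ a) ≠ ⊤ := by
    rw [lintegral_tsum fun k => (hφk k).ennreal_ofReal.aemeasurable]
    refine ne_top_of_le_ne_top
      (summable_geometric_of_lt_one hθ hθ1).tsum_ofReal_ne_top (ENNReal.tsum_le_tsum fun k => ?_)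
    rw [← ofReal_integral_eq_lintegral_ofReal (hi k) (.of_forall fun ω => hφ0 _)]
    exact ENNReal.ofReal_le_ofReal (hdecay k)
  refine ⟨fun ω => 2 * (M ω).toReal,
    (integrable_toReal_of_lintegral_ne_top hMm.aemeasurable hM).const_mul 2, ?_⟩
  filter_upwards [ae_lt_top hMm hM] with ω hω k
  have h1 : ∑ j ∈ Finset.range k, φ (ω j) ≤ (M ω).toReal := by
    rw [← ENNReal.ofReal_le_iff_le_toReal hω.ne, ENNReal.ofReal_sum_of_nonneg fun _ _ => hφ0 _]
    exact ENNReal.sum_le_tsum _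
  refine le_trans ?_ (mul_le_mul_of_nonneg_left h1 zero_le_two)
  rw [Finset.mul_sum]
  refine Finset.sum_le_sum fun j _ => ?_
  simp only [φ]
  split_ifs
  · linarith [hψ (ω j).1]
  · simp

/-- The game ends almost surely, and the scores along the game have an integrable majorant. -/
lemma exists_integrable_abs_score_le (hn : 0 < n) (S₁ S₂ : G.Strategy) (a : G.State) :
    (∀ᵐ ω ∂(G.law S₁ S₂ a), G.Exits ω) ∧
    ∃ N : (ℕ → G.State) → ℝ, Integrable N (G.law S₁ S₂ a) ∧
      ∀ᵐ ω ∂(G.law S₁ S₂ a), ∀ k, |(ω k).2| ≤ N ω := by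
  classical
  obtain ⟨N, hN, hsum⟩ := exists_integrable_sum_le hn S₁ S₂ a
  constructor
  · filter_upwards [hsum] with ω hω
    by_contra hne
    have hin : ∀ j, ((ω j).1 : EuclideanSpace ℝ (Fin n)) ∈ G.Ω := fun j =>
      (ω j).1.2.resolve_right fun h => hne ⟨j, h⟩
    obtain ⟨k, hk⟩ := exists_nat_gt (N ω)
    have := hω k
    simp only [hin, if_true, Finset.sum_const, Finset.card_range, nsmul_eq_mul, mul_one] at this
    linarith
  · refine ⟨fun ω => |a.2| + G.ε * N ω, (integrable_const _).add (hN.const_mul _), ?_⟩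
    filter_upwards [hsum, ae_law_zero S₁ S₂ a, ae_law_succ S₁ S₂ a] with ω hω h0 hs k
    have key : ∀ k, |(ω k).2| ≤ |a.2| + G.ε * ∑ j ∈ Finset.range k,
        (if ((ω j).1 : EuclideanSpace ℝ (Fin n)) ∈ G.Ω then (1 : ℝ) else 0) := by
      intro k
      induction k with
      | zero => simp [h0]
      | succ k ih =>
        rw [Finset.sum_range_succ]
        split_ifs with hx
        · have h1 := (hs k).1
          have h2 := abs_sub_abs_le_abs_sub (ω (k + 1)).2 (ω k).2
          linarith
        · rw [(hs k).2 hx]; linarith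
    exact (key k).trans (by have := hω k; have := G.ε_pos; gcongr)

/-! ### The value process -/

/-- The value process `v(x_k) + s_k` has an integrable majorant and converges almost surely to the
payoff. -/
lemma tendsto_integral_value (hn : 0 < n) {F : G.strip → ℝ} {v : G.Pos → ℝ}
    (hv : G.IsSolution F v) (S₁ S₂ : G.Strategy) (a : G.State) :
    (∀ k, Integrable (fun ω : ℕ → G.State => v (ω k).1 + (ω k).2) (G.law S₁ S₂ a)) ∧
    Integrable (G.payoff F) (G.law S₁ S₂ a) ∧
    Tendsto (fun k => ∫ ω, (v (ω k).1 + (ω k).2) ∂(G.law S₁ S₂ a)) atTop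
      (𝓝 (G.expectedPayoff F S₁ S₂ a)) := by
  classical
  obtain ⟨hex, N, hN, hNle⟩ := exists_integrable_abs_score_le hn S₁ S₂ a
  obtain ⟨C, hC⟩ := hv.bounded
  have hm : ∀ k, Measurable fun ω : ℕ → G.State => v (ω k).1 + (ω k).2 := fun k =>
    (hv.measurable.comp (measurable_fst.comp (measurable_pi_apply k))).add
      (measurable_snd.comp (measurable_pi_apply k))
  have hdom : Integrable (fun ω => C + N ω) (G.law S₁ S₂ a) := (integrable_const C).add hN
  have hb : ∀ᵐ ω ∂(G.law S₁ S₂ a), ∀ k, ‖v (ω k).1 + (ω k).2‖ ≤ C + N ω := by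
    filter_upwards [hNle] with ω hω k
    exact (norm_add_le _ _).trans (add_le_add (hC _) (hω k))
  have hlim : ∀ᵐ ω ∂(G.law S₁ S₂ a),
      Tendsto (fun k => v (ω k).1 + (ω k).2) atTop (𝓝 (G.payoff F ω)) := by
    filter_upwards [hex, ae_law_succ S₁ S₂ a] with ω hω hs
    have hconst : ∀ k, Nat.find hω ≤ k → ω k = ω (Nat.find hω) := fun k hk => by
      induction k, hk using Nat.le_induction with
      | base => rfl
      | succ k hk ih =>
        rw [(hs k).2 (by rw [ih]; exact (Nat.find_spec hω).1), ih]
    refine tendsto_const_nhds.congr' ?_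
    filter_upwards [eventually_ge_atTop (Nat.find hω)] with k hk
    rw [hconst k hk, payoff, dif_pos hω, ← hv.boundary]
  refine ⟨fun k => hdom.mono' (hm k).aestronglyMeasurable (hb.mono fun ω h => h k), ?_, ?_⟩
  · refine hdom.mono' (aestronglyMeasurable_of_tendsto_ae atTop
      (fun k => (hm k).aestronglyMeasurable) hlim) ?_
    filter_upwards [hb, hlim] with ω h1 h2
    exact le_of_tendsto' h2.norm h1
  · exact tendsto_integral_of_dominated_convergence _ (fun k => (hm k).aestronglyMeasurable) hdom
      (fun k => hb.mono fun ω h => h k) hlim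

/-- If the value process, multiplied by the sign `c`, loses in the mean at most `δ k` in step `k`,
then the expected payoff, multiplied by `c`, is at least the initial value minus the total loss.
With `c = 1` this is used for Player I, with `c = -1` for Player II. -/
lemma le_mul_expectedPayoff (hn : 0 < n) {F : G.strip → ℝ} {v : G.Pos → ℝ}
    (hv : G.IsSolution F v) (S₁ S₂ : G.Strategy) (a : G.State) (c : ℝ) {δ : ℕ → ℝ} {η : ℝ}
    (hδ0 : ∀ k, 0 ≤ δ k) (hδ : ∀ k, ∑ j ∈ Finset.range k, δ j ≤ η)
    (hstep : ∀ k (h : G.History k), ((G.last h).1 : EuclideanSpace ℝ (Fin n)) ∈ G.Ω →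
      c * (v (G.last h).1 + (G.last h).2) - δ k ≤
        c * ∫ y, (v y.1 + y.2) ∂(G.stepLaw S₁ S₂ k h)) :
    c * (v a.1 + a.2) - η ≤ c * G.expectedPayoff F S₁ S₂ a := by
  obtain ⟨hi, -, hlim⟩ := tendsto_integral_value hn hv S₁ S₂ a
  have hVm : Measurable fun y : G.State => v y.1 + y.2 :=
    (hv.measurable.comp measurable_fst).add measurable_snd
  have key : ∀ k, c * (v a.1 + a.2) - ∑ j ∈ Finset.range k, δ j ≤
      c * ∫ ω, (v (ω k).1 + (ω k).2) ∂(G.law S₁ S₂ a) := by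
    intro k
    induction k with
    | zero =>
      have : ∫ ω, (v (ω 0).1 + (ω 0).2) ∂(G.law S₁ S₂ a) = v a.1 + a.2 := by
        rw [integral_congr_ae (g := fun _ => v a.1 + a.2)]
        · simp
        · filter_upwards [ae_law_zero S₁ S₂ a] with ω hω
          rw [hω]
      simp [this]
    | succ k ih =>
      obtain ⟨h1, h2⟩ := integral_law_succ S₁ S₂ a k hVm (hi (k + 1))
      rw [Finset.sum_range_succ, h2, ← integral_const_mul]
      have h3 : ∫ ω, (c * (v (ω k).1 + (ω k).2) - δ k) ∂(G.law S₁ S₂ a) ≤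
          ∫ ω, c * ∫ y, (v y.1 + y.2) ∂(G.stepLaw S₁ S₂ k (Preorder.frestrictLe k ω))
            ∂(G.law S₁ S₂ a) := by
        refine integral_mono (((hi k).const_mul c).sub (integrable_const _)) (h1.const_mul c) ?_
        intro ω
        by_cases hx : ((ω k).1 : EuclideanSpace ℝ (Fin n)) ∈ G.Ω
        · exact hstep k (Preorder.frestrictLe k ω) hx
        · have hl : G.last (Preorder.frestrictLe k ω) = ω k := rfl
          simp only
          rw [stepLaw_of_notMem S₁ S₂ (by rw [hl]; exact hx), integral_dirac, hl]
          linarith [hδ0 k]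
      rw [integral_sub ((hi k).const_mul c) (integrable_const _), integral_const_mul] at h3
      simp only [integral_const, probReal_univ, smul_eq_mul, one_mul] at h3
      linarith
  exact ge_of_tendsto' (hlim.const_mul c) fun k => by linarith [key k, hδ k]

/-- The dynamic programming principle, read as a formula for the mean of the value process after one
step. -/
lemma IsSolution.integral_stepLaw_eq {F : G.strip → ℝ} {v : G.Pos → ℝ}
    (hv : G.IsSolution F v) (S₁ S₂ : G.Strategy) {k : ℕ} {h : G.History k}
    (hx : ((G.last h).1 : EuclideanSpace ℝ (Fin n)) ∈ G.Ω) :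
    ∫ y, (v y.1 + y.2) ∂(G.stepLaw S₁ S₂ k h) = v (G.last h).1 + (G.last h).2
      + G.α / 2 * (v (S₁.move k h) + G.tilt (G.last h).1 (S₁.move k h)
        - G.supTilt v (G.last h).1)
      + G.α / 2 * (v (S₂.move k h) - G.tilt (G.last h).1 (S₂.move k h)
        - G.infTilt v (G.last h).1) := by
  obtain ⟨C, hC⟩ := hv.bounded
  have hVm : Measurable fun y : G.State => v y.1 + y.2 :=
    (hv.measurable.comp measurable_fst).add measurable_snd
  have i0 := G.integrable_comp_shift hv.measurable hC (G.last h).1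
  rw [integral_stepLaw S₁ S₂ hx hVm (i0.add (integrable_const _)),
    integral_add i0 (integrable_const _)]
  simp only [integral_const, probReal_univ, smul_eq_mul, one_mul]
  have h1 := hv.interior _ hx
  rw [setIntegral_mul_ρ] at h1
  linear_combination (G.last h).2 * G.α_add_β - h1

lemma sum_range_half_pow_le {η : ℝ} (hη : 0 < η) (k : ℕ) :
    ∑ j ∈ Finset.range k, η * (1 / 2) ^ (j + 1) ≤ η := by
  rw [← Finset.mul_sum]
  refine mul_le_of_le_one_right hη.le ?_
  have h : ∑ j ∈ Finset.range k, (1 / 2 : ℝ) ^ (j + 1) = 1 - (1 / 2) ^ k := by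
    induction k with
    | zero => simp
    | succ k ih => rw [Finset.sum_range_succ, ih]; ring
  rw [h]
  linarith [show (0 : ℝ) ≤ (1 / 2) ^ k by positivity]

/-- Player I can guarantee the value of the solution up to an arbitrarily small error. -/
lemma IsSolution.exists_strategy_le (hn : 0 < n) {F : G.strip → ℝ} {v : G.Pos → ℝ}
    (hv : G.IsSolution F v) (a : G.State) {η : ℝ} (hη : 0 < η) :
    ∃ S₁ : G.Strategy, ∀ S₂, v a.1 + a.2 - η ≤ G.expectedPayoff F S₁ S₂ a := by
  obtain ⟨C, hC⟩ := hv.bounded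
  choose f hfm hf using fun k : ℕ => exists_measurable_supTilt_sub_le hC
    (η := η * (1 / 2) ^ (k + 1)) (by positivity)
  refine ⟨markovStrategy f hfm fun k x => (hf k x).1, fun S₂ => ?_⟩
  have := le_mul_expectedPayoff hn hv (markovStrategy f hfm fun k x => (hf k x).1) S₂ a 1
    (fun k => by positivity) (sum_range_half_pow_le hη) fun k h hx => ?_
  · simpa using this
  rw [hv.integral_stepLaw_eq _ _ hx]
  have h1 := (hf k (G.last h).1).2
  have h2 := infTilt_le hC (S₂.admissible k h hx)
  have hα := G.α_nonneg
  have hα1 : G.α ≤ 1 := by linarith [G.α_add_β, G.β_nonneg]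
  have hδ : 0 < η * (1 / 2) ^ (k + 1) := by positivity
  simp only [markovStrategy]
  nlinarith

/-- Player II can guarantee the value of the solution up to an arbitrarily small error. -/
lemma IsSolution.exists_strategy_ge (hn : 0 < n) {F : G.strip → ℝ} {v : G.Pos → ℝ}
    (hv : G.IsSolution F v) (a : G.State) {η : ℝ} (hη : 0 < η) :
    ∃ S₂ : G.Strategy, ∀ S₁, G.expectedPayoff F S₁ S₂ a ≤ v a.1 + a.2 + η := by
  obtain ⟨C, hC⟩ := hv.bounded
  choose f hfm hf using fun k : ℕ => exists_measurable_le_infTilt_add hC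
    (η := η * (1 / 2) ^ (k + 1)) (by positivity)
  refine ⟨markovStrategy f hfm fun k x => (hf k x).1, fun S₁ => ?_⟩
  have := le_mul_expectedPayoff hn hv S₁ (markovStrategy f hfm fun k x => (hf k x).1) a (-1)
    (fun k => by positivity) (sum_range_half_pow_le hη) fun k h hx => ?_
  · linarith
  rw [hv.integral_stepLaw_eq _ _ hx]
  have h1 := (hf k (G.last h).1).2
  have h2 := le_supTilt hC (S₁.admissible k h hx)
  have hα := G.α_nonneg
  have hα1 : G.α ≤ 1 := by linarith [G.α_add_β, G.β_nonneg]
  have hδ : 0 < η * (1 / 2) ^ (k + 1) := by positivity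
  simp only [markovStrategy]
  nlinarith

lemma IsSolution.value_eq (hn : 0 < n) {F : G.strip → ℝ} {v : G.Pos → ℝ}
    (hv : G.IsSolution F v) (a : G.State) :
    G.lowerValue F a = ((v a.1 + a.2 : ℝ) : EReal) ∧
      G.upperValue F a = ((v a.1 + a.2 : ℝ) : EReal) := by
  have hle : G.lowerValue F a ≤ G.upperValue F a := iSup_iInf_le_iInf_iSup _
  have h1 : ((v a.1 + a.2 : ℝ) : EReal) ≤ G.lowerValue F a := by
    refine EReal.ge_of_forall_gt_iff_ge.1 fun z hz => ?_
    have hz' := EReal.coe_lt_coe_iff.1 hz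
    obtain ⟨S₁, hS₁⟩ := hv.exists_strategy_le hn a (sub_pos.2 hz')
    refine le_iSup_of_le S₁ (le_iInf fun S₂ => EReal.coe_le_coe_iff.2 ?_)
    linarith [hS₁ S₂]
  have h2 : G.upperValue F a ≤ ((v a.1 + a.2 : ℝ) : EReal) := by
    refine EReal.le_of_forall_lt_iff_le.1 fun z hz => ?_
    have hz' := EReal.coe_lt_coe_iff.1 hz
    obtain ⟨S₂, hS₂⟩ := hv.exists_strategy_ge hn a (sub_pos.2 hz')
    refine iInf_le_of_le S₂ (iSup_le fun S₁ => EReal.coe_le_coe_iff.2 ?_)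
    linarith [hS₂ S₁]
  exact ⟨le_antisymm (hle.trans h2) h1, le_antisymm h2 (h1.trans hle)⟩

end Setting
end TiltedTugOfWar
end

open TiltedTugOfWar in
theorem mainTheorem2 {n : ℕ} (hn : 0 < n) (G : Setting n) (F : G.strip → ℝ)
    (hF : Measurable F) (hFb : ∃ C, ∀ x, |F x| ≤ C) :
    ∃ v : G.Pos → ℝ, G.IsSolution F v ∧ (∀ w, G.IsSolution F w → w = v) ∧
      ∀ x₀ : G.Pos, (x₀ : EuclideanSpace ℝ (Fin n)) ∈ G.Ω →
        (∀ s₀ : ℝ,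
          (∀ S₁ S₂ : G.Strategy,
            (∀ᵐ ω ∂(G.law S₁ S₂ (x₀, s₀)), G.Exits ω) ∧
            MeasureTheory.Integrable (G.payoff F) (G.law S₁ S₂ (x₀, s₀))) ∧
          G.lowerValue F (x₀, s₀) = ((v x₀ + s₀ : ℝ) : EReal) ∧
          G.upperValue F (x₀, s₀) = ((v x₀ + s₀ : ℝ) : EReal)) ∧
        G.lowerValue F (x₀, 0) = (v x₀ : EReal) ∧
        G.upperValue F (x₀, 0) = (v x₀ : EReal) := by
  obtain ⟨v, hv⟩ := Setting.exists_isSolution hn hF hFb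
  refine ⟨v, hv, fun w hw => hv.eq hn hw, fun x₀ _ => ⟨fun s₀ => ⟨fun S₁ S₂ => ⟨?_, ?_⟩, ?_⟩, ?_⟩⟩
  · exact (Setting.exists_integrable_abs_score_le hn S₁ S₂ _).1
  · exact (Setting.tendsto_integral_value hn hv S₁ S₂ _).2.1
  · exact hv.value_eq hn (x₀, s₀)
  · simpa using hv.value_eq hn (x₀, 0)
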